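/- Let $d\ge 1$, let $X\subseteq\mathbb R^d$, and let $k\colon X\times X\to\mathbb R$ be a strictly positive definite kernel with reproducing kernel Hilbert space $\mathcal H(X)$. For $\beta>d/2$ let $W_2^\beta(\mathbb R^d)$ be the space of (continuous representatives of) real functions $g\in L^2(\mathbb R^d)$ with $\|g\|_{W_2^\beta(\mathbb R^d)}=\|\hat g\,(1+\|\cdot\|^2)^{\beta/2}\|_{L^2(\mathbb R^d)}<\infty$, and let $W_2^\beta(X)$ be the space of restrictions $g_{|X}$ of functions $g\in W_2^\beta(\mathbb R^d)$, with the norm $\|h\|_{W_2^\beta(X)}=\inf\{\|g\|_{W_2^\beta(\mathbb R^d)} : g\in W_2^\beta(\mathbb R^d),\ g_{|X}=h\}$. Suppose that $k$ has Sobolev regularity $\alpha>0$, that is, $\mathcal H(X)=W_2^{\alpha+d/2}(X)$ as function spaces, with equivalent norms. Let $R_1,\dots,R_q\subseteq\mathbb R$ be pairwise disjoint closed intervals (possibly unbounded) of non-zero length. For $f\in\mathcal H(X)$ put $X_j=\{x\in X: f(x)\in R_j\}$, and let $\mathcal H_{R,X}(f)$ be the set of all $h\in\mathcal H(X)$ such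 that, for every $x\in X$, $h(x)\in R_j$ if $f(x)\in R_j$ for some $j$, and $h(x)=f(x)$ otherwise. Proposition. Let $f\in\mathcal H(X)$ and suppose that for some $j\in\{1,\dots,q\}$ the set $X_j$ has non-empty interior in $\mathbb R^d$. Then $$\sup_{h\in\mathcal H_{R,X}(f)}\|h\|_{\mathcal H(X)}=+\infty .$$ Consequently the norm reduction obtained by relaxation can be arbitrarily large: $\mathcal H_{R,X}(f)$ has an element $s$ of minimal norm, and for every $M\in\mathbb R$ there is $g\in\mathcal H(X)$ with $\mathcal H_{R,X}(g)=\mathcal H_{R,X}(f)$ (so $g$ has the same relaxed minimal-norm approximation $s$) and $\|g\|_{\mathcal H(X)}-\|s\|_{\mathcal H(X)}>M$. -/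

import Mathlib

open MeasureTheory
open scoped ENNReal NNReal FourierTransform InnerProductSpace

noncomputable section

namespace RelaxedGP

/-- The Euclidean space `ℝ^d`. -/
abbrev Euc (d : ℕ) : Type := EuclideanSpace ℝ (Fin d)

/-- The norm `‖û (1 + ‖·‖²)^(β/2)‖_{L²}` of a class `u ∈ L²(ℝ^d)`, where `û` is the (unitary)
`L²` Fourier transform; the value is `∞` when `û (1 + ‖·‖²)^(β/2)` is not square-integrable.
Another normalization of the Fourier transform gives an equivalent norm. -/
def sobolevNormL2 {d : ℕ} (β : ℝ) (u : Lp ℂ 2 (volume : Measure (Euc d))) : ℝ≥0∞ :=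
  eLpNorm (fun ξ : Euc d => (((1 + ‖ξ‖ ^ 2) ^ (β / 2) : ℝ) : ℂ) * (𝓕 u) ξ) 2 volume

open Classical in
/-- The norm of `W_2^β(ℝ^d)` evaluated at a real function on `ℝ^d`; it is `∞` on functions that
are not in `L²(ℝ^d)`. -/
def sobolevNorm {d : ℕ} (β : ℝ) (g : Euc d → ℝ) : ℝ≥0∞ :=
  if hg : MemLp (fun x => (g x : ℂ)) 2 (volume : Measure (Euc d)) then
    sobolevNormL2 β (hg.toLp (fun x => (g x : ℂ)))
  else ∞

/-- The space `W_2^β(ℝ^d)` of real functions, in the range `β > d/2` where every class has exactly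
one continuous representative: an element of the space is identified with that representative,
so that its values at points, and its restriction to an arbitrary subset, make sense. -/
def sobolevSpace (d : ℕ) (β : ℝ) : Set (Euc d → ℝ) :=
  {g | Continuous g ∧ sobolevNorm β g < ∞}

/-- The space `W_2^β(X)` of restrictions to `X ⊆ ℝ^d` of the elements of `W_2^β(ℝ^d)`
(for `β > d/2`). -/
def sobolevSpaceOn {d : ℕ} (X : Set (Euc d)) (β : ℝ) : Set (X → ℝ) :=
  {h | ∃ g ∈ sobolevSpace d β, X.domRestrict g = h}

/-- The norm of `W_2^β(X)`: the infimum of the norms of the extensions in `W_2^β(ℝ^d)`. -/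
def sobolevNormOn {d : ℕ} (X : Set (Euc d)) (β : ℝ) (h : X → ℝ) : ℝ≥0∞ :=
  ⨅ g ∈ {g : Euc d → ℝ | g ∈ sobolevSpace d β ∧ X.domRestrict g = h}, sobolevNorm β g

/-- `k` is the reproducing kernel of the Hilbert space of functions `H`: `k(x, ·) ∈ H` and
`(f, k(x, ·))_H = f(x)` for all `x` and all `f ∈ H`. -/
def IsReproducingKernel {X : Type*} (H : Type*) [NormedAddCommGroup H] [InnerProductSpace ℝ H]
    [RKHS ℝ H X ℝ] (k : X → X → ℝ) : Prop :=
  ∀ x : X, ∃ kx : H, (∀ y, kx y = k x y) ∧ ∀ f : H, ⟪f, kx⟫_ℝ = f x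

/-- The kernel `k` on `X ⊆ ℝ^d`, with reproducing kernel Hilbert space `H`, has Sobolev regularity
`α`: it is strictly positive definite, and `H` coincides with `W_2^(α + d/2)(X)` as a space of
functions, with equivalent norms. -/
structure HasSobolevRegularity {d : ℕ} (X : Set (Euc d)) (H : Type*) [NormedAddCommGroup H]
    [InnerProductSpace ℝ H] [RKHS ℝ H X ℝ] (k : X → X → ℝ) (α : ℝ) : Prop where
  reproducing : IsReproducingKernel H k
  posDef : (Matrix.of k).PosDef
  range_eq : Set.range (fun (h : H) (x : X) => h x) = sobolevSpaceOn X (α + d / 2)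
  norm_equiv : ∃ c C : ℝ≥0, 0 < c ∧ ∀ h : H,
    (c : ℝ≥0∞) * ‖h‖ₑ ≤ sobolevNormOn X (α + d / 2) (fun x => h x) ∧
      sobolevNormOn X (α + d / 2) (fun x => h x) ≤ (C : ℝ≥0∞) * ‖h‖ₑ

/-- `R_1, …, R_q` are pairwise disjoint closed intervals (possibly unbounded) of the real line with
non-zero lengths. -/
structure IsRelaxationFamily {q : ℕ} (R : Fin q → Set ℝ) : Prop where
  closed : ∀ j, IsClosed (R j)
  interval : ∀ j, (R j).OrdConnected
  nontrivial : ∀ j, (R j).Nontrivial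
  disjoint : Pairwise fun i j => Disjoint (R i) (R j)

/-- The region `X_j = {x ∈ X, f(x) ∈ R_j}`, as a subset of `ℝ^d`. -/
def region {d : ℕ} (X : Set (Euc d)) (f : X → ℝ) (Rj : Set ℝ) : Set (Euc d) :=
  {x | ∃ hx : x ∈ X, f ⟨x, hx⟩ ∈ Rj}

/-- The set `H_{R,U}` of the functions `h ∈ H` such that, for all `x ∈ U`, `h(x) ∈ R_j` if
`f(x) ∈ R_j` for some `j`, and `h(x) = f(x)` otherwise. -/
def relaxedSet {X : Type*} {H : Type*} [NormedAddCommGroup H] [InnerProductSpace ℝ H]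
    [RKHS ℝ H X ℝ] {q : ℕ} (R : Fin q → Set ℝ) (U : Set X) (f : H) : Set H :=
  {h | ∀ x ∈ U, (∀ j, f x ∈ R j → h x ∈ R j) ∧ ((∀ j, f x ∉ R j) → h x = f x)}

end RelaxedGP

end

namespace RelaxedGP

open Filter Topology Set

/-! Continuity of the elements of `H` clashes with weak compactness. Near an interior point of the
region, `f` can be shifted by `τ * t`, `t ∈ [0, 1]`, without leaving `R j`
(`exists_ball_forall_add_mul_mem`). So `f + τ • b n` is in the relaxed set for bumps `b n` of height
1 shrinking to a point `y`. Were the norms bounded, `exists_coe_eq_of_tendsto_of_norm_le` would put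
the pointwise limit, `f` altered only at `y`, in `H`, although it is discontinuous. Only the
equality of function spaces is used, no norm estimate. For the consequence, every member of the
relaxed set has the same relaxed set, so members of large norm serve as `g`. -/

/-- Smooth compactly supported functions belong to every Sobolev space. -/
lemma mem_sobolevSpace_of_hasCompactSupport {d : ℕ} (β : ℝ) {g : Euc d → ℝ}
    (hc : HasCompactSupport g) (hg : ContDiff ℝ (⊤ : ℕ∞) g) : g ∈ sobolevSpace d β := by
  refine ⟨hg.continuous, ?_⟩
  have hc' : HasCompactSupport (fun x => (g x : ℂ)) :=
    hc.comp_left (g := fun t : ℝ => (t : ℂ)) Complex.ofReal_zero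
  have hg' : ContDiff ℝ (⊤ : ℕ∞) (fun x => (g x : ℂ)) := Complex.ofRealCLM.contDiff.comp hg
  let S : SchwartzMap (Euc d) ℂ := hc'.toSchwartzMap hg'
  have hSg : (S : Euc d → ℂ) = fun x => (g x : ℂ) := rfl
  have hS : MemLp (fun x => (g x : ℂ)) 2 (volume : Measure (Euc d)) := hSg ▸ S.memLp 2 volume
  have hlp : hS.toLp (fun x => (g x : ℂ)) = S.toLp 2 := rfl
  rw [sobolevNorm, dif_pos hS, sobolevNormL2, hlp, SchwartzMap.toLp_fourier_eq]
  -- The weight has temperate growth, so its product with the Schwartz function `𝓕 S` is again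
  -- Schwartz.
  have ht : (fun ξ : Euc d => (((1 + ‖ξ‖ ^ 2) ^ (β / 2) : ℝ) : ℂ)).HasTemperateGrowth := by
    have := Function.hasTemperateGrowth_one_add_norm_sq_rpow (Euc d) (β / 2)
    fun_prop
  have hT := (SchwartzMap.smulLeftCLM ℂ
    (fun ξ : Euc d => (((1 + ‖ξ‖ ^ 2) ^ (β / 2) : ℝ) : ℂ)) (𝓕 S)).eLpNorm_lt_top 2
      (volume : Measure (Euc d))
  refine lt_of_eq_of_lt (eLpNorm_congr_ae ?_) hT
  filter_upwards [(𝓕 S).coeFn_toLp 2 (volume : Measure (Euc d))] with ξ hξ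
  rw [hξ, SchwartzMap.smulLeftCLM_apply_apply ht, smul_eq_mul]

/-- The pointwise limit of a norm-bounded sequence in an RKHS belongs to the RKHS. -/
lemma exists_coe_eq_of_tendsto_of_norm_le {X H : Type*} [NormedAddCommGroup H]
    [InnerProductSpace ℝ H] [CompleteSpace H] [RKHS ℝ H X ℝ] {u : ℕ → H} {v : X → ℝ} {C : ℝ}
    (hu : ∀ n, ‖u n‖ ≤ C) (hv : ∀ x, Tendsto (fun n => u n x) atTop (𝓝 (v x))) :
    ∃ h : H, ∀ x, h x = v x := by
  let w : ℕ → WeakDual ℝ H := fun n => StrongDual.toWeakDual (InnerProductSpace.toDual ℝ H (u n))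
  obtain ⟨φ, -, hφ⟩ := (WeakDual.isCompact_closedBall (𝕜 := ℝ) (E := H) 0 C).exists_mapClusterPt
    (f := atTop) (u := w) (by
      refine tendsto_principal.2 (Eventually.of_forall fun n => ?_)
      simpa [w] using hu n)
  refine ⟨(InnerProductSpace.toDual ℝ H).symm (WeakDual.toStrongDual φ), fun x => ?_⟩
  -- Evaluation at `x` is pairing with the kernel function, hence weak-* continuous: `φ` paired with
  -- it is a cluster point of `u n x`, which must be the limit `v x`.
  have hcl := hφ.continuousAt_comp
    (WeakDual.eval_continuous (𝕜 := ℝ) (RKHS.kerFun H x (1 : ℝ))).continuousAt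
  have hw : (fun ψ : WeakDual ℝ H => ψ (RKHS.kerFun H x (1 : ℝ))) ∘ w = fun n => u n x := by
    funext n
    change ⟪u n, RKHS.kerFun H x (1 : ℝ)⟫_ℝ = u n x
    simp
  rw [hw] at hcl
  have hφx : (InnerProductSpace.toDual ℝ H).symm (WeakDual.toStrongDual φ) x
      = φ (RKHS.kerFun H x (1 : ℝ)) := by
    have := RKHS.inner_kerFun (𝕜 := ℝ) x (1 : ℝ)
      ((InnerProductSpace.toDual ℝ H).symm (WeakDual.toStrongDual φ))
    rw [InnerProductSpace.toDual_symm_apply] at this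
    simpa using this.symm
  rw [hφx]
  have : (𝓝 (φ (RKHS.kerFun H x (1 : ℝ))) ⊓ 𝓝 (v x)).NeBot :=
    NeBot.mono hcl (inf_le_inf_left _ (hv x))
  exact eq_of_nhds_neBot this

/-- A continuous function with values in a nondegenerate interval on an open ball can be shifted
in some direction without leaving the interval, uniformly on a smaller ball. -/
lemma exists_ball_forall_add_mul_mem {E : Type*} [NormedAddCommGroup E] [NormedSpace ℝ E]
    {F : E → ℝ} (hF : Continuous F) {R : Set ℝ} (hR : R.OrdConnected) (hnt : R.Nontrivial)
    {x₀ : E} {r : ℝ} (hr : 0 < r) (hFR : ∀ x ∈ Metric.ball x₀ r, F x ∈ R) :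
    ∃ y, ∃ ρ > 0, ∃ τ : ℝ, τ ≠ 0 ∧ Metric.ball y ρ ⊆ Metric.ball x₀ r ∧
      ∀ x ∈ Metric.ball y ρ, ∀ t ∈ Icc (0 : ℝ) 1, F x + τ * t ∈ R := by
  have hx₀ := Metric.mem_ball_self (x := x₀) hr
  by_cases h : ∃ y ∈ Metric.ball x₀ r, F y ∈ interior R
  · obtain ⟨y, hy, hyR⟩ := h
    obtain ⟨ε, hε, hεR⟩ := Metric.mem_nhds_iff.1 (mem_interior_iff_mem_nhds.1 hyR)
    obtain ⟨ρ, hρ, hρs⟩ := Metric.mem_nhds_iff.1 (inter_mem (Metric.isOpen_ball.mem_nhds hy)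
      (hF.continuousAt.preimage_mem_nhds (Metric.ball_mem_nhds (F y) (half_pos hε))))
    -- Half of `ε` absorbs the oscillation of `F`, half the shift.
    refine ⟨y, ρ, hρ, ε / 2, (half_pos hε).ne', fun x hx => (hρs hx).1, fun x hx t ht => hεR ?_⟩
    have hd : |F x - F y| < ε / 2 := by simpa [Real.dist_eq] using (hρs hx).2
    rw [Metric.mem_ball, Real.dist_eq, abs_lt]
    rw [abs_lt] at hd
    have h0 : 0 ≤ ε / 2 * t := mul_nonneg (half_pos hε).le ht.1
    have h1 : ε / 2 * t ≤ ε / 2 := mul_le_of_le_one_right (half_pos hε).le ht.2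
    constructor <;> linarith
  · push Not at h
    -- Two distinct values would, by the intermediate value theorem, put an open interval of values
    -- inside `R`, hence in its interior.
    have hconst : ∀ y ∈ Metric.ball x₀ r, F y = F x₀ := by
      have key : ∀ y ∈ Metric.ball x₀ r, ∀ z ∈ Metric.ball x₀ r, ¬ F y < F z := by
        intro y hy z hz hlt
        obtain ⟨m, hm⟩ := exists_between hlt
        have hpre := ((convex_ball x₀ r).isPreconnected.image F hF.continuousOn).ordConnected
        obtain ⟨w, hw, rfl⟩ := hpre.out (mem_image_of_mem F hy) (mem_image_of_mem F hz)
          (Ioo_subset_Icc_self hm)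
        exact h w hw (mem_interior.2 ⟨Ioo (F y) (F z),
          Ioo_subset_Icc_self.trans (hR.out (hFR y hy) (hFR z hz)), isOpen_Ioo, hm⟩)
      exact fun y hy => le_antisymm (not_lt.1 (key _ hx₀ _ hy)) (not_lt.1 (key _ hy _ hx₀))
    obtain ⟨b, hb, hne⟩ := hnt.exists_ne (F x₀)
    refine ⟨x₀, r, hr, b - F x₀, sub_ne_zero.2 hne, Subset.rfl, fun x hx t ht => ?_⟩
    rw [hconst x hx]
    have := hR.convex.add_smul_sub_mem (hFR x₀ hx₀) hb ht
    simpa [mul_comm] using this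

variable {X H : Type*} [NormedAddCommGroup H] [InnerProductSpace ℝ H] [RKHS ℝ H X ℝ]
  {q : ℕ} {R : Fin q → Set ℝ} {f : H}

lemma self_mem_relaxedSet (U : Set X) : f ∈ relaxedSet R U f :=
  fun _ _ => ⟨fun _ h => h, fun _ => rfl⟩

/-- By disjointness, `h` cannot enter an interval other than the one containing `f x`, so `f` and
`h` have the same regions, and they agree off them. -/
lemma relaxedSet_eq_of_mem (hR : Pairwise fun i j => Disjoint (R i) (R j)) {U : Set X} {h : H}
    (hh : h ∈ relaxedSet R U f) : relaxedSet R U h = relaxedSet R U f := by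
  have hiff : ∀ x ∈ U, ∀ j, h x ∈ R j ↔ f x ∈ R j := by
    refine fun x hx j => ⟨fun hj => ?_, (hh x hx).1 j⟩
    by_cases hex : ∃ i, f x ∈ R i
    · obtain ⟨i, hi⟩ := hex
      rcases eq_or_ne i j with rfl | hij
      · exact hi
      · exact absurd hj (disjoint_left.1 (hR hij) ((hh x hx).1 i hi))
    · push Not at hex
      exact (hh x hx).2 hex ▸ hj
  ext g
  refine forall₂_congr fun x hx => and_congr ?_ ?_
  · simp only [hiff x hx]
  · simp only [hiff x hx]
    exact forall_congr' fun hn => by rw [(hh x hx).2 hn]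

lemma isClosed_relaxedSet (hR : ∀ j, IsClosed (R j)) (U : Set X) :
    IsClosed (relaxedSet R U f) := by
  simp only [relaxedSet, ofPred_forall, ofPred_and]
  refine isClosed_biInter fun x _ => IsClosed.inter ?_ ?_
  · exact isClosed_iInter fun j => isClosed_iInter fun _ =>
      (hR j).preimage (RKHS.continuous_eval x)
  · exact isClosed_iInter fun _ => isClosed_eq (RKHS.continuous_eval x) continuous_const

lemma convex_relaxedSet (hR : ∀ j, (R j).OrdConnected) (U : Set X) :
    Convex ℝ (relaxedSet R U f) := by
  intro g hg h hh a b ha hb hab x hx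
  refine ⟨fun j hj => ?_, fun hn => ?_⟩
  · simpa using (hR j).convex ((hg x hx).1 j hj) ((hh x hx).1 j hj) ha hb hab
  · simp [(hg x hx).2 hn, (hh x hx).2 hn, ← add_mul, hab]

/-- The minimizer is the projection of `0` onto a nonempty closed convex set. -/
lemma exists_norm_le_of_mem_relaxedSet [CompleteSpace H] (hR : IsRelaxationFamily R)
    (U : Set X) : ∃ s ∈ relaxedSet R U f, ∀ h ∈ relaxedSet R U f, ‖s‖ ≤ ‖h‖ := by
  obtain ⟨s, hs, hmin⟩ := exists_norm_eq_iInf_of_complete_convex ⟨f, self_mem_relaxedSet U⟩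
    (isClosed_relaxedSet hR.closed U).isComplete (convex_relaxedSet hR.interval U) (0 : H)
  refine ⟨s, hs, fun h hh => ?_⟩
  have := ciInf_le (f := fun w : relaxedSet R U f => ‖(0 : H) - w‖)
    ⟨0, by rintro _ ⟨w, rfl⟩; exact norm_nonneg _⟩ ⟨h, hh⟩
  rw [← hmin] at this
  simpa using this

/-- If the relaxation takes place on a set with interior points, the relaxed set is unbounded:
perturbing `f` by ever narrower bumps gives a sequence with a discontinuous pointwise limit. -/
lemma exists_mem_relaxedSet_norm_gt {d : ℕ} (hd : 1 ≤ d) {X : Set (Euc d)} {H : Type*}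
    [NormedAddCommGroup H] [InnerProductSpace ℝ H] [CompleteSpace H] [RKHS ℝ H X ℝ]
    {β : ℝ} (hH : range (fun (h : H) (x : X) => h x) = sobolevSpaceOn X β)
    (hR : IsRelaxationFamily R) {f : H} {j : Fin q}
    (hint : (interior (region X (fun x => f x) (R j))).Nonempty) (M : ℝ) :
    ∃ h ∈ relaxedSet R univ f, M < ‖h‖ := by
  have hcont : ∀ h : H, ∃ F : Euc d → ℝ, Continuous F ∧ ∀ x : X, h x = F x := by
    intro h
    obtain ⟨F, hF, hFh⟩ : (fun x : X => h x) ∈ sobolevSpaceOn X β := hH ▸ mem_range_self h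
    exact ⟨F, hF.1, fun x => (congrFun hFh x).symm⟩
  obtain ⟨F, hF, hfF⟩ := hcont f
  obtain ⟨x₀, hx₀⟩ := hint
  obtain ⟨r, hr, hrs⟩ := Metric.mem_nhds_iff.1 (mem_interior_iff_mem_nhds.1 hx₀)
  obtain ⟨y, ρ, hρ, τ, hτ, hsub, hmem⟩ := exists_ball_forall_add_mul_mem hF (hR.interval j)
    (hR.nontrivial j) hr fun x hx => by
      obtain ⟨hxX, hfx⟩ := hrs hx
      exact hfF ⟨x, hxX⟩ ▸ hfx
  have hballX : Metric.ball y ρ ⊆ X := fun x hx => (hrs (hsub hx)).1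
  have hrad : ∀ n : ℕ, 0 < ρ / (n + 1) := fun n => by positivity
  let ψ : ∀ _ : ℕ, ContDiffBump y := fun n =>
    ⟨ρ / (n + 1) / 2, ρ / (n + 1), half_pos (hrad n), half_lt_self (hrad n)⟩
  have hψ : ∀ n, ∃ b : H, ∀ x : X, b x = ψ n x := by
    intro n
    have : X.domRestrict (ψ n) ∈ range (fun (h : H) (x : X) => h x) :=
      hH ▸ ⟨_, mem_sobolevSpace_of_hasCompactSupport β (ψ n).hasCompactSupport (ψ n).contDiff, rfl⟩
    obtain ⟨b, hb⟩ := this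
    exact ⟨b, fun x => congrFun hb x⟩
  choose b hb using hψ
  have hzero : ∀ (n : ℕ) (x : Euc d), x ∉ Metric.ball y (ρ / (n + 1)) → ψ n x = 0 := fun n x hx =>
    (ψ n).zero_of_le_dist (by simpa using hx)
  have hu : ∀ n, f + τ • b n ∈ relaxedSet R univ f := by
    intro n x _
    have hval : (f + τ • b n) x = f x + τ * ψ n x := by simp [hb]
    rw [hval]
    by_cases hx : (x : Euc d) ∈ Metric.ball y ρ
    · have hj : f x ∈ R j := (hrs (hsub hx)).2
      refine ⟨fun i hi => ?_, fun hn => absurd hj (hn j)⟩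
      obtain rfl : i = j := by
        by_contra hij
        exact disjoint_left.1 (hR.disjoint hij) hi hj
      rw [hfF]
      exact hmem x hx _ ⟨(ψ n).nonneg, (ψ n).le_one⟩
    · have h0 : ψ n x = 0 := hzero n x fun h => hx
        (Metric.ball_subset_ball (div_le_self hρ.le (by simp)) h)
      simp [h0]
  by_contra! hbd
  obtain ⟨h, hh⟩ := exists_coe_eq_of_tendsto_of_norm_le
    (v := fun x : X => f x + τ * ({y} : Set (Euc d)).indicator 1 (x : Euc d))
    (fun n => hbd _ (hu n)) (by
      intro x
      have hval : ∀ n, (f + τ • b n) x = f x + τ * ψ n x := fun n => by simp [hb]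
      simp only [hval]
      refine (Tendsto.const_mul τ ?_).const_add _
      by_cases hx : (x : Euc d) = y
      · have h1 : ∀ n, ψ n x = 1 := fun n => (ψ n).one_of_mem_closedBall (by
          rw [hx]; exact Metric.mem_closedBall_self (ψ n).rIn_pos.le)
        simp only [h1]
        simp [hx]
      · rw [indicator_of_notMem (by simpa using hx)]
        have hlim : Tendsto (fun n : ℕ => ρ / ((n : ℝ) + 1)) atTop (𝓝 0) :=
          by
          simpa [div_eq_mul_inv] using
            (tendsto_one_div_add_atTop_nhds_zero_nat (𝕜 := ℝ)).const_mul ρ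
        refine tendsto_const_nhds.congr' ?_
        filter_upwards [hlim.eventually_lt_const (dist_pos.2 hx)] with n hn
        exact (hzero n x (by simpa using hn.le)).symm)
  obtain ⟨G, hG, hhG⟩ := hcont h
  -- Since `d ≥ 1`, `y` is not isolated, so limits along `𝓝[≠] y` are unique. They force `G y = F
  -- y`, against `h y = f y + τ`.
  have : Nonempty (Fin d) := ⟨⟨0, hd⟩⟩
  have hev : ∀ᶠ x in 𝓝[≠] y, G x = F x := by
    filter_upwards [mem_nhdsWithin_of_mem_nhds (Metric.ball_mem_nhds y hρ), self_mem_nhdsWithin]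
      with x hx hxy
    have := hh ⟨x, hballX hx⟩
    rw [indicator_of_notMem (by simpa using hxy), hhG, hfF] at this
    simpa using this
  have hlimG : Tendsto G (𝓝[≠] y) (𝓝 (G y)) := hG.continuousAt.mono_left nhdsWithin_le_nhds
  have hlimF : Tendsto F (𝓝[≠] y) (𝓝 (F y)) := hF.continuousAt.mono_left nhdsWithin_le_nhds
  have hGF : G y = F y := tendsto_nhds_unique (hlimG.congr' hev) hlimF
  have hy := hh ⟨y, hballX (Metric.mem_ball_self hρ)⟩
  rw [hhG, hfF, hGF] at hy
  simp [hτ] at hy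

end RelaxedGP

theorem mainTheorem5 {d : ℕ} (hd : 1 ≤ d) (X : Set (RelaxedGP.Euc d))
    {H : Type*} [NormedAddCommGroup H] [InnerProductSpace ℝ H] [CompleteSpace H] [RKHS ℝ H X ℝ]
    (k : X → X → ℝ) (α : ℝ) (hα : 0 < α) (hk : RelaxedGP.HasSobolevRegularity X H k α)
    {q : ℕ} (R : Fin q → Set ℝ) (hR : RelaxedGP.IsRelaxationFamily R) (f : H)
    (hint : ∃ j, (interior (RelaxedGP.region X (fun x => f x) (R j))).Nonempty) :
    (⨆ h ∈ RelaxedGP.relaxedSet R Set.univ f, ‖h‖ₑ) = ⊤ ∧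
      ∃ s ∈ RelaxedGP.relaxedSet R Set.univ f,
        (∀ h ∈ RelaxedGP.relaxedSet R Set.univ f, ‖s‖ ≤ ‖h‖) ∧
        ∀ M : ℝ, ∃ g : H,
          RelaxedGP.relaxedSet R Set.univ g = RelaxedGP.relaxedSet R Set.univ f ∧
            M < ‖g‖ - ‖s‖ := by
  obtain ⟨j, hj⟩ := hint
  have hunb := RelaxedGP.exists_mem_relaxedSet_norm_gt hd hk.range_eq hR hj
  obtain ⟨s, hs, hmin⟩ :=
    RelaxedGP.exists_norm_le_of_mem_relaxedSet (f := f) hR Set.univ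
  refine ⟨ENNReal.eq_top_of_forall_nnreal_le fun M => ?_, s, hs, hmin, fun M => ?_⟩
  · obtain ⟨h, hh, hM⟩ := hunb M
    refine le_trans ?_ (le_iSup₂ (f := fun (h : H) _ => ‖h‖ₑ) h hh)
    exact ENNReal.coe_le_coe.2 (NNReal.coe_le_coe.1 hM.le)
  · obtain ⟨h, hh, hM⟩ := hunb (M + ‖s‖)
    exact ⟨h, RelaxedGP.relaxedSet_eq_of_mem hR.disjoint hh, by linarith⟩
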